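/- Let $p\in\mathbb{N}_0$ and $R>0$, let $K=B(0,R)\subset\mathbb{R}^2$ be the open disc of radius $R$ centred at the origin, and let $v$ be a real polynomial in two variables of total degree at most $p$ on $K$. Then $$\|\nabla v\|_{K}^2\le 9\,p\,(p+1)^2(p+2)\,R^{-2}\,\|v\|_{K}^2,$$ where $\|\cdot\|_K$ denotes the $L^2(K)$-norm, i.e. $\|v\|_K^2=\int_K |v|^2\,dx$ and $\|\nabla v\|_K^2=\int_K|\nabla v|^2\,dx$ with the Euclidean norm of the gradient. -/

import Mathlib

open MeasureTheory

/-- `v ∈ 𝒫_p(K)`: on `K ⊆ ℝ²`, `v` coincides with a real polynomial in the two coordinates, of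
total degree at most `p`. -/
def IsPolynomialOn (p : ℕ) (K : Set (EuclideanSpace ℝ (Fin 2)))
    (v : EuclideanSpace ℝ (Fin 2) → ℝ) : Prop :=
  ∃ q : MvPolynomial (Fin 2) ℝ, q.totalDegree ≤ p ∧
    ∀ x ∈ K, v x = MvPolynomial.eval (fun i => x i) q

/-- The squared `L²(K)`-norm of a scalar or vector field on `K ⊆ ℝ²`, for Lebesgue measure and the
Euclidean norm of the values. -/
noncomputable def l2NormSq {F : Type*} [NormedAddCommGroup F]
    (K : Set (EuclideanSpace ℝ (Fin 2))) (f : EuclideanSpace ℝ (Fin 2) → F) : ℝ :=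
  ∫ x in K, ‖f x‖ ^ 2

open Polynomial

/-! The estimate reduces to one dimension along chords of the disc.

In one variable, `‖f'‖² ≤ n(n+1)²(n+2)/4 · ‖f‖²` on `[-1, 1]` for degree at most `n`. The monic
Legendre polynomial `L` of degree `k` satisfies `‖L'‖² = d ‖L‖²` with `d = k(k+1)(2k+1)/2`.
Splitting the top Legendre component off `f` and weighting Young's inequality suitably adds `d` to
the constant at each degree, and these numbers sum to `n(n+1)²(n+2)/4`
(`symmIntegral_derivative_sq_le`).

Scaled to a chord at distance `y` from the centre, the inequality carries the weight `R² - y²`,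
which degenerates near the boundary for derivatives along short chords. Integrating over all
parallel chords bounds a weighted directional derivative
(`integral_sub_directional_derivative_nonneg`). The weights of four directions together dominate
`R²/2 · |∇v|²` throughout the disc (`half_mul_sq_add_sq_le`). This gives the constant 2, hence 9. -/

/-- Integration of real polynomials over `[-1, 1]`. -/
noncomputable def symmIntegral : ℝ[X] →ₗ[ℝ] ℝ where
  toFun f := ∫ x in (-1 : ℝ)..1, f.eval x
  map_add' f g := by
    simp only [eval_add]
    exact intervalIntegral.integral_add (f.continuous.intervalIntegrable _ _)
      (g.continuous.intervalIntegrable _ _)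
  map_smul' c f := by
    simp only [eval_smul, RingHom.id_apply]
    exact intervalIntegral.integral_smul _ _

theorem symmIntegral_apply (f : ℝ[X]) : symmIntegral f = ∫ x in (-1 : ℝ)..1, f.eval x := rfl

theorem symmIntegral_derivative (f : ℝ[X]) :
    symmIntegral (derivative f) = f.eval 1 - f.eval (-1) := by
  rw [symmIntegral_apply]
  exact intervalIntegral.integral_eq_sub_of_hasDerivAt (fun x _ => f.hasDerivAt x)
    ((derivative f).continuous.intervalIntegrable _ _)

theorem symmIntegral_C_mul (c : ℝ) (f : ℝ[X]) :
    symmIntegral (C c * f) = c * symmIntegral f := by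
  rw [← smul_eq_C_mul, map_smul, smul_eq_mul]

theorem symmIntegral_sq_nonneg (f : ℝ[X]) : 0 ≤ symmIntegral (f ^ 2) := by
  rw [symmIntegral_apply]
  refine intervalIntegral.integral_nonneg (by norm_num) fun x _ => ?_
  rw [eval_pow]
  positivity

theorem eq_zero_of_symmIntegral_sq_eq_zero {f : ℝ[X]} (h : symmIntegral (f ^ 2) = 0) : f = 0 := by
  by_contra hf
  have hfin : (f.rootSet ℝ).Finite := f.rootSet_finite ℝ
  obtain ⟨c, hc, hcf⟩ : ∃ c ∈ Set.Icc (-1 : ℝ) 1, c ∉ f.rootSet ℝ :=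
    ((Set.Icc_infinite (by norm_num : (-1 : ℝ) < 1)).sdiff hfin).nonempty
  have hne : f.eval c ≠ 0 := by
    intro h0
    exact hcf (by rw [mem_rootSet]; exact ⟨hf, by simpa using h0⟩)
  have : 0 < ∫ x in (-1 : ℝ)..1, (f ^ 2).eval x := by
    refine intervalIntegral.integral_pos (by norm_num) (f ^ 2).continuous.continuousOn
      (fun x _ => by rw [eval_pow]; positivity) ⟨c, hc, ?_⟩
    rw [eval_pow]
    positivity
  rw [symmIntegral_apply] at h
  exact this.ne' h

/-! ### Monic Legendre polynomials -/

/-- `L` is the monic polynomial of degree `n` that is orthogonal on `[-1, 1]` to all polynomials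
of lower degree. -/
structure IsMonicLegendre (n : ℕ) (L : ℝ[X]) : Prop where
  degree_lt : L.degree < (n + 1 : ℕ)
  coeff_eq_one : L.coeff n = 1
  orthogonal : ∀ h : ℝ[X], h.degree < n → symmIntegral (L * h) = 0

theorem degree_sub_C_coeff_mul_lt {n : ℕ} {L f : ℝ[X]} (hL : L.degree < (n + 1 : ℕ))
    (hL1 : L.coeff n = 1) (hf : f.degree < (n + 1 : ℕ)) :
    (f - C (f.coeff n) * L).degree < n := by
  rw [degree_lt_iff_coeff_zero] at *
  intro m hm
  rcases hm.eq_or_lt with rfl | h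
  · simp [hL1]
  · simp [hL m h, hf m h]

theorem IsMonicLegendre.ne_zero {n : ℕ} {L : ℝ[X]} (hL : IsMonicLegendre n L) : L ≠ 0 := by
  rintro rfl
  simpa using hL.coeff_eq_one

theorem IsMonicLegendre.symmIntegral_sq_ne_zero {n : ℕ} {L : ℝ[X]} (hL : IsMonicLegendre n L) :
    symmIntegral (L ^ 2) ≠ 0 :=
  fun h => hL.ne_zero (eq_zero_of_symmIntegral_sq_eq_zero h)

theorem isMonicLegendre_X_pow_sub {n : ℕ} {g : ℝ[X]} (hg : g.degree < n)
    (h : ∀ h : ℝ[X], h.degree < n → symmIntegral ((X ^ n - g) * h) = 0) :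
    IsMonicLegendre n (X ^ n - g) where
  degree_lt := by
    rw [degree_lt_iff_coeff_zero] at *
    intro m hm
    rw [coeff_sub, hg m (by lia), coeff_X_pow, if_neg (by lia), sub_zero]
  coeff_eq_one := by
    rw [degree_lt_iff_coeff_zero] at hg
    simp [hg n le_rfl]
  orthogonal := h

theorem exists_orthogonal_projection (n : ℕ) (f : ℝ[X]) :
    ∃ g : ℝ[X], g.degree < n ∧ ∀ h : ℝ[X], h.degree < n → symmIntegral ((f - g) * h) = 0 := by
  induction n generalizing f with
  | zero =>
    refine ⟨0, by simp, fun h hh => ?_⟩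
    have : h = 0 := by simpa using hh
    simp [this]
  | succ n ih =>
    -- Gram–Schmidt: projecting `X ^ n` itself supplies the next orthogonal basis vector.
    obtain ⟨k, hk, hko⟩ := ih (X ^ n)
    have hL := isMonicLegendre_X_pow_sub hk hko
    generalize X ^ n - k = L at hL
    obtain ⟨g, hg, hgo⟩ := ih f
    have hgL : symmIntegral (g * L) = 0 := by rw [mul_comm]; exact hL.orthogonal g hg
    refine ⟨g + C (symmIntegral (f * L) / symmIntegral (L ^ 2)) * L, ?_, fun h hh => ?_⟩
    · refine (degree_add_le _ _).trans_lt (max_lt (hg.trans (by norm_cast; lia)) ?_)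
      rw [← smul_eq_C_mul]
      exact (degree_smul_le _ _).trans_lt hL.degree_lt
    · have hd := degree_sub_C_coeff_mul_lt hL.degree_lt hL.coeff_eq_one hh
      set a := h.coeff n
      set r := h - C a * L with hr
      set b := symmIntegral (f * L) / symmIntegral (L ^ 2) with hb
      have e : (f - (g + C b * L)) * h =
          (f - g) * r - C b * (L * r) + C a * (f * L - g * L - C b * L ^ 2) := by
        rw [hr]; ring
      rw [e]
      simp only [map_add, map_sub, symmIntegral_C_mul, hgo r hd, hL.orthogonal r hd, hgL]
      rw [hb, div_mul_cancel₀ _ hL.symmIntegral_sq_ne_zero]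
      ring

theorem exists_isMonicLegendre (n : ℕ) : ∃ L : ℝ[X], IsMonicLegendre n L := by
  obtain ⟨g, hg, hgo⟩ := exists_orthogonal_projection n (X ^ n)
  exact ⟨_, isMonicLegendre_X_pow_sub hg hgo⟩

theorem coeff_X_mul_derivative (f : ℝ[X]) (m : ℕ) :
    (X * derivative f).coeff m = m * f.coeff m := by
  cases m with
  | zero => simp
  | succ m => rw [coeff_X_mul, coeff_derivative]; push_cast; ring

/-- The Legendre differential operator `f ↦ ((1 - x²) f')'`, coefficientwise. -/
theorem coeff_legendre_operator (f : ℝ[X]) (m : ℕ) :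
    (derivative ((1 - X ^ 2) * derivative f)).coeff m =
      (m + 2) * (m + 1) * f.coeff (m + 2) - m * (m + 1) * f.coeff m := by
  have e : (1 - X ^ 2) * derivative f = derivative f - X * (X * derivative f) := by ring
  rw [e, derivative_sub, coeff_sub, coeff_derivative, coeff_derivative, coeff_derivative,
    coeff_X_mul, coeff_X_mul_derivative]
  push_cast
  ring

/-- Self-adjointness: the boundary terms vanish because `1 - x²` is zero at `±1`. -/
theorem symmIntegral_legendre_operator_mul (f g : ℝ[X]) :
    symmIntegral (derivative ((1 - X ^ 2) * derivative f) * g) =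
      symmIntegral (f * derivative ((1 - X ^ 2) * derivative g)) := by
  have h := symmIntegral_derivative
    ((1 - X ^ 2) * derivative f * g - f * ((1 - X ^ 2) * derivative g))
  have e : derivative ((1 - X ^ 2) * derivative f * g - f * ((1 - X ^ 2) * derivative g)) =
      derivative ((1 - X ^ 2) * derivative f) * g -
        f * derivative ((1 - X ^ 2) * derivative g) := by
    rw [derivative_sub, derivative_mul (f := (1 - X ^ 2) * derivative f),
      derivative_mul (f := f)]
    ring
  rw [e, map_sub] at h
  have h0 : ((1 - X ^ 2) * derivative f * g - f * ((1 - X ^ 2) * derivative g)).eval 1 -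
      ((1 - X ^ 2) * derivative f * g - f * ((1 - X ^ 2) * derivative g)).eval (-1 : ℝ) = 0 := by
    simp
  linarith

/-- In the left side `T` the coefficients of degree at least `n` cancel. The operator is
self-adjoint and keeps degree below `n`, so orthogonality of `L` makes `T` orthogonal to itself. -/
theorem IsMonicLegendre.differential_equation {n : ℕ} {L : ℝ[X]} (hL : IsMonicLegendre n L) :
    derivative ((1 - X ^ 2) * derivative L) + C ((n : ℝ) * (n + 1)) * L = 0 := by
  set T := derivative ((1 - X ^ 2) * derivative L) + C ((n : ℝ) * (n + 1)) * L with hT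
  have hc := degree_lt_iff_coeff_zero L (n + 1) |>.1 hL.degree_lt
  have hTd : T.degree < n := by
    rw [degree_lt_iff_coeff_zero]
    intro m hm
    rw [hT, coeff_add, coeff_legendre_operator, coeff_C_mul, hc (m + 2) (by lia)]
    rcases hm.eq_or_lt with rfl | h
    · ring
    · rw [hc m h]; ring
  have hT' : (derivative ((1 - X ^ 2) * derivative T)).degree < n := by
    rw [degree_lt_iff_coeff_zero] at *
    intro m hm
    rw [coeff_legendre_operator, hTd m hm, hTd (m + 2) (by lia)]
    ring
  apply eq_zero_of_symmIntegral_sq_eq_zero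
  have e : T ^ 2 = derivative ((1 - X ^ 2) * derivative L) * T +
      C ((n : ℝ) * (n + 1)) * (L * T) := by
    rw [sq]; nth_rw 1 [hT]; ring
  rw [e, map_add, symmIntegral_C_mul, symmIntegral_legendre_operator_mul, hL.orthogonal _ hT',
    hL.orthogonal _ hTd]
  ring

/-- Integrate `(x L²)'`: since `x L' - n L` has degree below `n`, it is orthogonal to `L`. -/
theorem IsMonicLegendre.eval_sq_add_eval_sq {n : ℕ} {L : ℝ[X]} (hL : IsMonicLegendre n L) :
    L.eval 1 ^ 2 + L.eval (-1) ^ 2 = (2 * n + 1) * symmIntegral (L ^ 2) := by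
  have hc := degree_lt_iff_coeff_zero L (n + 1) |>.1 hL.degree_lt
  have hd : (X * derivative L - C (n : ℝ) * L).degree < ((n : ℕ) : WithBot ℕ) := by
    rw [degree_lt_iff_coeff_zero]
    intro m hm
    rw [coeff_sub, coeff_X_mul_derivative, coeff_C_mul]
    rcases hm.eq_or_lt with rfl | h
    · ring
    · rw [hc m h]; ring
  have h := symmIntegral_derivative (X * L ^ 2)
  have e : derivative (X * L ^ 2) = C (2 * n + 1 : ℝ) * L ^ 2 +
      C 2 * (L * (X * derivative L - C (n : ℝ) * L)) := by
    rw [derivative_mul, derivative_X, derivative_pow]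
    simp only [map_add, map_mul, C_1]
    push_cast
    simp only [map_ofNat]
    ring
  rw [e, map_add, symmIntegral_C_mul, symmIntegral_C_mul, hL.orthogonal _ hd] at h
  simp only [eval_mul, eval_X, eval_pow] at h
  linarith

/-- Since `L ⊥ L''`, integration by parts leaves only the boundary terms of `L L'`. At `±1` the
differential equation reduces to `L'(±1) = ±n(n+1)/2 · L(±1)`. -/
theorem IsMonicLegendre.symmIntegral_derivative_sq {n : ℕ} {L : ℝ[X]}
    (hL : IsMonicLegendre n L) :
    symmIntegral (derivative L ^ 2) =
      (n : ℝ) * (n + 1) * (2 * n + 1) / 2 * symmIntegral (L ^ 2) := by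
  have hc := degree_lt_iff_coeff_zero L (n + 1) |>.1 hL.degree_lt
  have hd : (derivative (derivative L)).degree < n := by
    rw [degree_lt_iff_coeff_zero]
    intro m hm
    rw [coeff_derivative, coeff_derivative, hc _ (by lia)]
    ring
  have h := symmIntegral_derivative (L * derivative L)
  have e : derivative (L * derivative L) = derivative L ^ 2 + L * derivative (derivative L) := by
    rw [derivative_mul]; ring
  rw [e, map_add, hL.orthogonal _ hd] at h
  have ode := hL.differential_equation
  have h1 := congrArg (eval 1) ode
  have h2 := congrArg (eval (-1)) ode
  rw [derivative_mul] at h1 h2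
  simp at h1 h2
  simp only [eval_mul] at h
  have h3 := hL.eval_sq_add_eval_sq
  linear_combination h - L.eval 1 / 2 * h1 - L.eval (-1) / 2 * h2 + (n : ℝ) * (n + 1) / 2 * h3

/-! ### Markov inequality on an interval -/

/-- The Markov inequality in `L²(-1, 1)`. -/
theorem symmIntegral_derivative_sq_le {n : ℕ} {f : ℝ[X]} (hf : f.degree < (n + 1 : ℕ)) :
    symmIntegral (derivative f ^ 2) ≤
      (n : ℝ) * (n + 1) ^ 2 * (n + 2) / 4 * symmIntegral (f ^ 2) := by
  induction n generalizing f with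
  | zero =>
    have : f = C (f.coeff 0) := eq_C_of_degree_le_zero 
      (natDegree_le_iff_degree_le.1 (Nat.le_zero.2 (by
        by_cases h0 : f = 0
        · simp [h0]
        · have := (natDegree_lt_iff_degree_lt h0).2 hf
          lia)))
    rw [this]
    simp
  | succ n ih =>
    obtain ⟨L, hL⟩ := exists_isMonicLegendre (n + 1)
    obtain ⟨c, r, hr, rfl⟩ : ∃ (c : ℝ) (r : ℝ[X]), r.degree < (n + 1 : ℕ) ∧ f = C c * L + r :=
      ⟨_, _, degree_sub_C_coeff_mul_lt hL.degree_lt hL.coeff_eq_one hf, by ring⟩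
    have hLr := hL.orthogonal r hr
    have h1 := hL.symmIntegral_derivative_sq
    have h2 := ih hr
    have hnorm : symmIntegral ((C c * L + r) ^ 2) =
        c ^ 2 * symmIntegral (L ^ 2) + symmIntegral (r ^ 2) := by
      have e : (C c * L + r) ^ 2 = C (c ^ 2) * L ^ 2 + C (2 * c) * (L * r) + r ^ 2 := by
        simp only [C_pow, C_mul, C_ofNat]; ring
      rw [e, map_add, map_add, symmIntegral_C_mul, symmIntegral_C_mul, hLr]
      ring
    have hder : symmIntegral (derivative (C c * L + r) ^ 2) =
        c ^ 2 * symmIntegral (derivative L ^ 2) +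
          2 * c * symmIntegral (derivative L * derivative r) +
          symmIntegral (derivative r ^ 2) := by
      have e : derivative (C c * L + r) ^ 2 = C (c ^ 2) * derivative L ^ 2 +
          C (2 * c) * (derivative L * derivative r) + derivative r ^ 2 := by
        rw [derivative_add, derivative_C_mul]
        simp only [C_pow, C_mul, C_ofNat]; ring
      rw [e, map_add, map_add, symmIntegral_C_mul, symmIntegral_C_mul]
    have hsq : ∀ a b : ℝ, 0 ≤ a ^ 2 * symmIntegral (derivative L ^ 2) -
        2 * a * b * symmIntegral (derivative L * derivative r) +
          b ^ 2 * symmIntegral (derivative r ^ 2) := by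
      intro a b
      have e : (C a * derivative L - C b * derivative r) ^ 2 = C (a ^ 2) * derivative L ^ 2 -
          C (2 * a * b) * (derivative L * derivative r) + C (b ^ 2) * derivative r ^ 2 := by
        simp only [C_pow, C_mul, C_ofNat]; ring
      have := symmIntegral_sq_nonneg (C a * derivative L - C b * derivative r)
      rw [e, map_add, map_sub, symmIntegral_C_mul, symmIntegral_C_mul, symmIntegral_C_mul] at this
      exact this
    rw [hnorm, hder]
    have hd0 : (0 : ℝ) < ((n + 1 : ℕ) : ℝ) * ((n + 1 : ℕ) + 1) * (2 * (n + 1 : ℕ) + 1) / 2 := by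
      positivity
    set d := ((n + 1 : ℕ) : ℝ) * ((n + 1 : ℕ) + 1) * (2 * (n + 1 : ℕ) + 1) / 2 with hd
    have hS0 : (0 : ℝ) ≤ (n : ℝ) * (n + 1) ^ 2 * (n + 2) / 4 := by positivity
    set S := (n : ℝ) * (n + 1) ^ 2 * (n + 2) / 4 with hS
    have hSd : ((n + 1 : ℕ) : ℝ) * ((n + 1 : ℕ) + 1) ^ 2 * ((n + 1 : ℕ) + 2) / 4 = S + d := by
      rw [hS, hd]; push_cast; ring
    rw [hSd]
    have hL0 := symmIntegral_sq_nonneg L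
    have hr0 := symmIntegral_sq_nonneg r
    have hdr0 := symmIntegral_sq_nonneg (derivative r)
    generalize symmIntegral (L ^ 2) = A at *
    generalize symmIntegral (r ^ 2) = B at *
    generalize symmIntegral (derivative L ^ 2) = A' at *
    generalize symmIntegral (derivative r ^ 2) = B' at *
    generalize symmIntegral (derivative L * derivative r) = M at *
    subst h1
    -- `S = 0` occurs when `r` is constant. Young's weights then degenerate, but `B' = 0` forces the
    -- cross term to vanish.
    rcases hS0.eq_or_lt with h0 | hpos
    · rw [← h0] at h2 ⊢
      have hB' : B' = 0 := by linarith
      subst hB'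
      have hM : c * M = 0 := by
        by_contra hM
        -- With `B' = 0` the form is affine in its second argument; this value makes it `-1`.
        have h3 := hsq c ((c ^ 2 * (d * A) + 1) / (2 * (c * M)))
        have : 2 * c * ((c ^ 2 * (d * A) + 1) / (2 * (c * M))) * M = c ^ 2 * (d * A) + 1 := by
          have hc := left_ne_zero_of_mul hM
          have hM' := right_ne_zero_of_mul hM
          field_simp
        linarith
      nlinarith [mul_nonneg hd0.le hr0]
    · -- Young's inequality with weights `S` and `d`
      have h3 := hsq (c * S) d
      have h4 : 0 ≤ S * d * (S * c ^ 2 * A + d * B - 2 * c * M) := by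
        nlinarith [mul_le_mul_of_nonneg_left h2 (sq_nonneg d)]
      have h5 := nonneg_of_mul_nonneg_right h4 (mul_pos hpos hd0)
      linarith

/-- The Markov inequality in `L²(-a, a)`. -/
theorem integral_derivative_sq_le {n : ℕ} {f : ℝ[X]} (hf : f.natDegree ≤ n) {a : ℝ} (ha : 0 < a) :
    a ^ 2 * ∫ x in -a..a, (derivative f).eval x ^ 2 ≤
      (n : ℝ) * (n + 1) ^ 2 * (n + 2) / 4 * ∫ x in -a..a, f.eval x ^ 2 := by
  have hg : (f.comp (C a * X)).degree < (n + 1 : ℕ) := by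
    refine degree_le_natDegree.trans_lt ?_
    rw [natDegree_comp, natDegree_C_mul_X a ha.ne', mul_one]
    exact_mod_cast Nat.lt_succ_of_le hf
  have h := symmIntegral_derivative_sq_le hg
  have h1 : symmIntegral (derivative (f.comp (C a * X)) ^ 2) =
      a ^ 2 * (a⁻¹ * ∫ x in -a..a, (derivative f).eval x ^ 2) := by
    have := intervalIntegral.integral_comp_mul_left (a := -1) (b := 1)
      (fun x => (derivative f).eval x ^ 2) ha.ne'
    rw [mul_neg, mul_one, smul_eq_mul] at this
    rw [← this, symmIntegral_apply, ← intervalIntegral.integral_const_mul]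
    congr 1 with x
    simp [derivative_comp, mul_pow]
  have h2 : symmIntegral (f.comp (C a * X) ^ 2) = a⁻¹ * ∫ x in -a..a, f.eval x ^ 2 := by
    have := intervalIntegral.integral_comp_mul_left (a := -1) (b := 1)
      (fun x => f.eval x ^ 2) ha.ne'
    rw [mul_neg, mul_one, smul_eq_mul] at this
    rw [← this, symmIntegral_apply]
    congr 1 with x
    simp
  rw [h1, h2] at h
  have ha' : 0 < a⁻¹ := inv_pos.2 ha
  refine le_of_mul_le_mul_left ?_ ha'
  linarith

/-! ### Chords and rotations of the disc -/

/-- A continuous function whose integrals over all horizontal chords of a disc are nonnegative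
has a nonnegative integral over the disc. -/
theorem setIntegral_ball_nonneg_of_chords {R : ℝ} (hR : 0 < R)
    {g : EuclideanSpace ℝ (Fin 2) → ℝ} (hg : Continuous g)
    (h : ∀ y, y ^ 2 < R ^ 2 → 0 ≤ ∫ x in -√(R ^ 2 - y ^ 2)..√(R ^ 2 - y ^ 2), g !₂[x, y]) :
    0 ≤ ∫ x in Metric.ball 0 R, g x := by
  let e : EuclideanSpace ℝ (Fin 2) ≃ᵐ ℝ × ℝ :=
    (MeasurableEquiv.toLp 2 (Fin 2 → ℝ)).symm.trans MeasurableEquiv.finTwoArrow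
  have he : MeasurePreserving e volume volume :=
    (volume_preserving_finTwoArrow ℝ).comp
      (EuclideanSpace.volume_preserving_symm_measurableEquiv_toLp (Fin 2))
  have hes : ∀ x y, e.symm (x, y) = !₂[x, y] := fun x y => rfl
  have hint : Integrable ((Metric.ball 0 R).indicator g) volume := by
    rw [integrable_indicator_iff measurableSet_ball]
    exact (hg.continuousOn.integrableOn_compact (isCompact_closedBall 0 R)).mono_set
      Metric.ball_subset_closedBall
  have hint' : Integrable (fun z => (Metric.ball 0 R).indicator g (e.symm z)) volume :=
    (he.symm e).integrable_comp_of_integrable hint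
  rw [← integral_indicator measurableSet_ball, ← (he.symm e).integral_comp',
    Measure.volume_eq_prod, integral_prod_symm _ hint']
  refine integral_nonneg fun y => ?_
  have hmem : ∀ x, !₂[x, y] ∈ Metric.ball (0 : EuclideanSpace ℝ (Fin 2)) R ↔
      x ^ 2 + y ^ 2 < R ^ 2 := by
    intro x
    rw [mem_ball_zero_iff, EuclideanSpace.norm_eq, Real.sqrt_lt' hR]
    simp
  simp only [hes]
  by_cases hy : y ^ 2 < R ^ 2
  · have hind : (fun x => (Metric.ball 0 R).indicator g !₂[x, y]) =
        (Set.Ioo (-√(R ^ 2 - y ^ 2)) √(R ^ 2 - y ^ 2)).indicator fun x => g !₂[x, y] := by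
      ext x
      have hiff : !₂[x, y] ∈ Metric.ball (0 : EuclideanSpace ℝ (Fin 2)) R ↔
          x ∈ Set.Ioo (-√(R ^ 2 - y ^ 2)) √(R ^ 2 - y ^ 2) := by
        rw [hmem, Set.mem_Ioo, ← abs_lt, Real.lt_sqrt (abs_nonneg x), sq_abs, lt_sub_iff_add_lt]
      by_cases hx : x ∈ Set.Ioo (-√(R ^ 2 - y ^ 2)) √(R ^ 2 - y ^ 2)
      · rw [Set.indicator_of_mem hx, Set.indicator_of_mem (hiff.2 hx)]
      · rw [Set.indicator_of_notMem hx, Set.indicator_of_notMem (mt hiff.1 hx)]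
    rw [hind, integral_indicator measurableSet_Ioo, ← integral_Ioc_eq_integral_Ioo,
      ← intervalIntegral.integral_of_le (by linarith [Real.sqrt_nonneg (R ^ 2 - y ^ 2)])]
    exact h y hy
  · have hind : (fun x => (Metric.ball 0 R).indicator g !₂[x, y]) = 0 := by
      ext x
      refine Set.indicator_of_notMem (fun hx => hy ?_) _
      nlinarith [(hmem x).1 hx, sq_nonneg x]
    rw [hind]
    simp

/-- The rotation of the plane by the angle with cosine `c` and sine `s`. -/
noncomputable def planeRotation (c s : ℝ) (h : c ^ 2 + s ^ 2 = 1) :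
    EuclideanSpace ℝ (Fin 2) ≃ₗᵢ[ℝ] EuclideanSpace ℝ (Fin 2) :=
  LinearIsometry.toLinearIsometryEquiv
    { toFun := fun x => !₂[c * x 0 - s * x 1, s * x 0 + c * x 1]
      map_add' := fun x y => by
        ext i
        fin_cases i <;> simp <;> ring
      map_smul' := fun r x => by
        ext i
        fin_cases i <;> simp <;> ring
      norm_map' := fun x => by
        rw [EuclideanSpace.norm_eq, EuclideanSpace.norm_eq]
        congr 1
        simp
        linear_combination (x 0 ^ 2 + x 1 ^ 2) * h } rfl

theorem planeRotation_apply (c s : ℝ) (h : c ^ 2 + s ^ 2 = 1) (x : EuclideanSpace ℝ (Fin 2)) :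
    planeRotation c s h x = !₂[c * x 0 - s * x 1, s * x 0 + c * x 1] := rfl

theorem setIntegral_ball_comp_planeRotation (c s : ℝ) (h : c ^ 2 + s ^ 2 = 1) (R : ℝ)
    (g : EuclideanSpace ℝ (Fin 2) → ℝ) :
    ∫ x in Metric.ball 0 R, g (planeRotation c s h x) = ∫ x in Metric.ball 0 R, g x := by
  have := (planeRotation c s h).measurePreserving.setIntegral_preimage_emb
    (planeRotation c s h).toHomeomorph.measurableEmbedding g (Metric.ball 0 R)
  rwa [LinearIsometryEquiv.preimage_ball, map_zero] at this

/-! ### Plane polynomials: gradient and restriction to lines -/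

theorem continuous_mvPolynomial_eval (q : MvPolynomial (Fin 2) ℝ) :
    Continuous fun x : EuclideanSpace ℝ (Fin 2) => MvPolynomial.eval (fun i => x i) q :=
  (MvPolynomial.continuous_eval q).comp (by fun_prop)

theorem hasFDerivAt_mvPolynomial_eval (q : MvPolynomial (Fin 2) ℝ)
    (x : EuclideanSpace ℝ (Fin 2)) :
    HasFDerivAt (fun x : EuclideanSpace ℝ (Fin 2) => MvPolynomial.eval (fun i => x i) q)
      (∑ j, MvPolynomial.eval (fun i => x i) (MvPolynomial.pderiv j q) •
        (EuclideanSpace.proj j : EuclideanSpace ℝ (Fin 2) →L[ℝ] ℝ)) x := by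
  induction q using MvPolynomial.induction_on with
  | C a =>
    simp only [MvPolynomial.eval_C, MvPolynomial.pderiv_C, map_zero, zero_smul,
      Finset.sum_const_zero]
    exact hasFDerivAt_const a x
  | add f g hf hg =>
    simp only [map_add, add_smul, Finset.sum_add_distrib]
    exact hf.add hg
  | mul_X f k hf =>
    simp only [map_mul, MvPolynomial.eval_X]
    refine (hf.mul (EuclideanSpace.proj k :
      EuclideanSpace ℝ (Fin 2) →L[ℝ] ℝ).hasFDerivAt).congr_fderiv ?_
    ext v
    simp only [MvPolynomial.pderiv_mul, MvPolynomial.pderiv_X]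
    fin_cases k <;> simp <;> ring

theorem gradient_mvPolynomial_eval (q : MvPolynomial (Fin 2) ℝ)
    (x : EuclideanSpace ℝ (Fin 2)) :
    gradient (fun x : EuclideanSpace ℝ (Fin 2) => MvPolynomial.eval (fun i => x i) q) x =
      !₂[MvPolynomial.eval (fun i => x i) (MvPolynomial.pderiv 0 q),
        MvPolynomial.eval (fun i => x i) (MvPolynomial.pderiv 1 q)] := by
  refine HasGradientAt.gradient (hasGradientAt_iff_hasFDerivAt.2 ?_)
  refine (hasFDerivAt_mvPolynomial_eval q x).congr_fderiv ?_
  ext v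
  simp [PiLp.inner_apply]
  ring

/-- The restriction of a polynomial to the line `t ↦ (a₀ + b₀ t, a₁ + b₁ t)`. -/
noncomputable def lineRestriction (a b : Fin 2 → ℝ) (q : MvPolynomial (Fin 2) ℝ) : ℝ[X] :=
  MvPolynomial.aeval (fun i => C (b i) * X + C (a i)) q

theorem natDegree_lineRestriction_le (a b : Fin 2 → ℝ) {q : MvPolynomial (Fin 2) ℝ} {p : ℕ}
    (hq : q.totalDegree ≤ p) : (lineRestriction a b q).natDegree ≤ p := by
  simpa [lineRestriction] using MvPolynomial.aeval_natDegree_le q hq (fun i => C (b i) * X + C (a i))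
    (fun i => natDegree_linear_le)

theorem eval_lineRestriction (a b : Fin 2 → ℝ) (q : MvPolynomial (Fin 2) ℝ) (t : ℝ) :
    (lineRestriction a b q).eval t = MvPolynomial.eval (fun i => a i + b i * t) q := by
  induction q using MvPolynomial.induction_on with
  | C r => simp [lineRestriction]
  | add f g hf hg => simp_all [lineRestriction]
  | mul_X f k hf =>
    simp_all [lineRestriction]
    left
    ring

theorem derivative_lineRestriction (a b : Fin 2 → ℝ) (q : MvPolynomial (Fin 2) ℝ) :
    derivative (lineRestriction a b q) =
      ∑ j, C (b j) * lineRestriction a b (MvPolynomial.pderiv j q) := by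
  induction q using MvPolynomial.induction_on with
  | C r => simp [lineRestriction]
  | add f g hf hg =>
    simp only [lineRestriction, map_add, mul_add, Finset.sum_add_distrib] at *
    rw [hf, hg]
  | mul_X f k hf =>
    simp only [lineRestriction, map_mul, MvPolynomial.aeval_X, derivative_mul,
      MvPolynomial.pderiv_mul, MvPolynomial.pderiv_X] at *
    rw [hf]
    fin_cases k <;> simp <;> ring

/-! ### From chords to the full gradient -/

/-- The chordwise Markov inequality in the direction `(c, s)`, integrated over the disc. -/
theorem integral_sub_directional_derivative_nonneg (c s : ℝ) (h : c ^ 2 + s ^ 2 = 1)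
    {R : ℝ} (hR : 0 < R) {q : MvPolynomial (Fin 2) ℝ} {p : ℕ} (hq : q.totalDegree ≤ p) :
    0 ≤ ∫ x in Metric.ball (0 : EuclideanSpace ℝ (Fin 2)) R,
      ((p : ℝ) * (p + 1) ^ 2 * (p + 2) / 4 * MvPolynomial.eval (fun i => x i) q ^ 2 -
        (R ^ 2 - (c * x 1 - s * x 0) ^ 2) *
          (c * MvPolynomial.eval (fun i => x i) (MvPolynomial.pderiv 0 q) +
            s * MvPolynomial.eval (fun i => x i) (MvPolynomial.pderiv 1 q)) ^ 2) := by
  -- Rotate so that chords in direction `(c, s)` become horizontal; the weight then depends on the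
  -- height `y` alone.
  rw [← setIntegral_ball_comp_planeRotation c s h]
  have h0 := continuous_mvPolynomial_eval q
  have h1 := continuous_mvPolynomial_eval (MvPolynomial.pderiv 0 q)
  have h2 := continuous_mvPolynomial_eval (MvPolynomial.pderiv 1 q)
  refine setIntegral_ball_nonneg_of_chords hR ?_ fun y hy => ?_
  · refine Continuous.comp
      (g := fun x : EuclideanSpace ℝ (Fin 2) =>
        (p : ℝ) * (p + 1) ^ 2 * (p + 2) / 4 * MvPolynomial.eval (fun i => x i) q ^ 2 -
        (R ^ 2 - (c * x 1 - s * x 0) ^ 2) *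
          (c * MvPolynomial.eval (fun i => x i) (MvPolynomial.pderiv 0 q) +
            s * MvPolynomial.eval (fun i => x i) (MvPolynomial.pderiv 1 q)) ^ 2)
      ?_ (planeRotation c s h).continuous
    fun_prop
  · have hpos : 0 < R ^ 2 - y ^ 2 := sub_pos.2 hy
    set a := √(R ^ 2 - y ^ 2) with ha
    have ha0 : 0 < a := Real.sqrt_pos.2 hpos
    have ha2 : a ^ 2 = R ^ 2 - y ^ 2 := Real.sq_sqrt hpos.le
    set f := lineRestriction ![-s * y, c * y] ![c, s] q with hf
    have key := integral_derivative_sq_le (natDegree_lineRestriction_le ![-s * y, c * y] ![c, s] hq)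
      ha0
    rw [← hf, ← intervalIntegral.integral_const_mul, ← intervalIntegral.integral_const_mul,
      ← sub_nonneg, ← intervalIntegral.integral_sub
        (Continuous.intervalIntegrable (by fun_prop) _ _)
        (Continuous.intervalIntegrable (by fun_prop) _ _)] at key
    refine key.trans_eq (intervalIntegral.integral_congr fun t _ => ?_)
    have hpt : ∀ r : MvPolynomial (Fin 2) ℝ,
        MvPolynomial.eval (fun i => planeRotation c s h !₂[t, y] i) r =
          (lineRestriction ![-s * y, c * y] ![c, s] r).eval t := by
      intro r
      rw [eval_lineRestriction]
      congr 2
      ext i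
      rw [planeRotation_apply]
      fin_cases i <;> simp <;> ring
    have hline : c * planeRotation c s h !₂[t, y] 1 - s * planeRotation c s h !₂[t, y] 0 = y := by
      rw [planeRotation_apply]
      simp
      linear_combination y * h
    simp only [hline, hpt, hf, derivative_lineRestriction, ha2]
    simp [Fin.sum_univ_two]

/-- Averaging the weighted directional derivatives over the four directions `e₁`, `e₂`,
`(e₁ ± e₂) / √2` controls the full gradient. -/
theorem half_mul_sq_add_sq_le {R x y g h : ℝ} (hr : x ^ 2 + y ^ 2 ≤ R ^ 2) :
    R ^ 2 / 2 * (g ^ 2 + h ^ 2) ≤ (R ^ 2 - y ^ 2) * g ^ 2 + (R ^ 2 - x ^ 2) * h ^ 2 +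
      (R ^ 2 - (y - x) ^ 2 / 2) * ((g + h) ^ 2 / 2) +
      (R ^ 2 - (y + x) ^ 2 / 2) * ((g - h) ^ 2 / 2) := by
  -- The right side equals `(2R² - 3/2 · (x² + y²))(g² + h²) + (x g + y h)²`.
  nlinarith [sq_nonneg (x * g + y * h),
    mul_nonneg (sub_nonneg.2 hr) (add_nonneg (sq_nonneg g) (sq_nonneg h))]

theorem integral_ball_gradient_sq_le {R : ℝ} (hR : 0 < R) {q : MvPolynomial (Fin 2) ℝ} {p : ℕ}
    (hq : q.totalDegree ≤ p) :
    R ^ 2 * ∫ x in Metric.ball (0 : EuclideanSpace ℝ (Fin 2)) R,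
        (MvPolynomial.eval (fun i => x i) (MvPolynomial.pderiv 0 q) ^ 2 +
          MvPolynomial.eval (fun i => x i) (MvPolynomial.pderiv 1 q) ^ 2) ≤
      2 * ((p : ℝ) * (p + 1) ^ 2 * (p + 2)) *
        ∫ x in Metric.ball (0 : EuclideanSpace ℝ (Fin 2)) R,
          MvPolynomial.eval (fun i => x i) q ^ 2 := by
  have hint : ∀ g : EuclideanSpace ℝ (Fin 2) → ℝ, Continuous g →
      IntegrableOn g (Metric.ball 0 R) := fun g hg =>
    (hg.continuousOn.integrableOn_compact (isCompact_closedBall 0 R)).mono_set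
      Metric.ball_subset_closedBall
  have hs : (√2 / 2) ^ 2 = (1 / 2 : ℝ) := by
    rw [div_pow, Real.sq_sqrt (by norm_num)]; norm_num
  have k1 := integral_sub_directional_derivative_nonneg 1 0 (by norm_num) hR hq
  have k2 := integral_sub_directional_derivative_nonneg 0 1 (by norm_num) hR hq
  have k3 := integral_sub_directional_derivative_nonneg (√2 / 2) (√2 / 2) (by rw [hs]; norm_num) hR hq
  have k4 := integral_sub_directional_derivative_nonneg (√2 / 2) (-(√2 / 2))
    (by rw [neg_sq, hs]; norm_num) hR hq
  have h0 := continuous_mvPolynomial_eval q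
  have h1 := continuous_mvPolynomial_eval (MvPolynomial.pderiv 0 q)
  have h2 := continuous_mvPolynomial_eval (MvPolynomial.pderiv 1 q)
  have k12 := add_nonneg k1 k2
  have k34 := add_nonneg k3 k4
  rw [← integral_add (hint _ (by fun_prop)) (hint _ (by fun_prop))] at k12 k34
  have k := add_nonneg k12 k34
  rw [← integral_add (hint _ (by fun_prop)) (hint _ (by fun_prop))] at k
  rw [← integral_const_mul, ← integral_const_mul, ← sub_nonneg,
    ← integral_sub (hint _ (by fun_prop)) (hint _ (by fun_prop))]
  -- The factor 2 turns the weight `R²/2` into `R²`, and the four constants `P/4`, with `P =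
  -- p(p+1)²(p+2)`, into `2P`.
  refine (mul_nonneg zero_le_two k).trans ?_
  rw [← integral_const_mul]
  refine setIntegral_mono_on (hint _ (by fun_prop)) (hint _ (by fun_prop)) measurableSet_ball
    fun x hx => ?_
  have hr : x 0 ^ 2 + x 1 ^ 2 ≤ R ^ 2 := by
    rw [mem_ball_zero_iff, EuclideanSpace.norm_eq, Real.sqrt_lt' hR] at hx
    simpa using hx.le
  have key := half_mul_sq_add_sq_le hr
    (g := MvPolynomial.eval (fun i => x i) (MvPolynomial.pderiv 0 q))
    (h := MvPolynomial.eval (fun i => x i) (MvPolynomial.pderiv 1 q))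
  generalize MvPolynomial.eval (fun i => x i) q = V at *
  generalize MvPolynomial.eval (fun i => x i) (MvPolynomial.pderiv 0 q) = g at *
  generalize MvPolynomial.eval (fun i => x i) (MvPolynomial.pderiv 1 q) = h at *
  have e1 : (√2 / 2 * x 1 - √2 / 2 * x 0) ^ 2 = (x 1 - x 0) ^ 2 / 2 := by
    linear_combination (x 1 - x 0) ^ 2 * hs
  have e2 : (√2 / 2 * x 1 - -(√2 / 2) * x 0) ^ 2 = (x 1 + x 0) ^ 2 / 2 := by
    linear_combination (x 1 + x 0) ^ 2 * hs
  have e3 : (√2 / 2 * g + √2 / 2 * h) ^ 2 = (g + h) ^ 2 / 2 := by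
    linear_combination (g + h) ^ 2 * hs
  have e4 : (√2 / 2 * g + -(√2 / 2) * h) ^ 2 = (g - h) ^ 2 / 2 := by
    linear_combination (g - h) ^ 2 * hs
  rw [e1, e2, e3, e4]
  linarith

theorem mainTheorem11 (p : ℕ) (R : ℝ) (hR : 0 < R) (v : EuclideanSpace ℝ (Fin 2) → ℝ)
    (hv : IsPolynomialOn p (Metric.ball 0 R) v) :
    l2NormSq (Metric.ball 0 R) (gradient v) ≤
      9 * (p : ℝ) * ((p : ℝ) + 1) ^ 2 * ((p : ℝ) + 2) * R ^ (-2 : ℤ) *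
        l2NormSq (Metric.ball 0 R) v := by
  obtain ⟨q, hq, hvq⟩ := hv
  have hval : l2NormSq (Metric.ball 0 R) v =
      ∫ x in Metric.ball (0 : EuclideanSpace ℝ (Fin 2)) R,
        MvPolynomial.eval (fun i => x i) q ^ 2 := by
    refine setIntegral_congr_fun measurableSet_ball fun x hx => ?_
    simp only [hvq x hx, Real.norm_eq_abs, sq_abs]
  have hgrad : l2NormSq (Metric.ball 0 R) (gradient v) =
      ∫ x in Metric.ball (0 : EuclideanSpace ℝ (Fin 2)) R,
        (MvPolynomial.eval (fun i => x i) (MvPolynomial.pderiv 0 q) ^ 2 +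
          MvPolynomial.eval (fun i => x i) (MvPolynomial.pderiv 1 q) ^ 2) := by
    refine setIntegral_congr_fun measurableSet_ball fun x hx => ?_
    -- `v` is arbitrary off the disc, but openness makes the gradients agree inside.
    have hev : v =ᶠ[nhds x] fun x => MvPolynomial.eval (fun i => x i) q :=
      Filter.eventually_of_mem (Metric.isOpen_ball.mem_nhds hx) hvq
    have : gradient v x = gradient (fun x : EuclideanSpace ℝ (Fin 2) =>
        MvPolynomial.eval (fun i => x i) q) x := by
      rw [gradient, gradient, hev.fderiv_eq]
    simp only [this, gradient_mvPolynomial_eval, EuclideanSpace.norm_sq_eq]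
    simp
  have key := integral_ball_gradient_sq_le hR hq
  rw [← hval, ← hgrad] at key
  have hV : 0 ≤ l2NormSq (Metric.ball 0 R) v :=
    integral_nonneg fun x => by positivity
  have hR2 : 0 < R ^ 2 := by positivity
  have hz : R ^ (-2 : ℤ) = (R ^ 2)⁻¹ := by
    rw [zpow_neg]; norm_cast
  have hP : 0 ≤ (p : ℝ) * (p + 1) ^ 2 * (p + 2) * l2NormSq (Metric.ball 0 R) v := by positivity
  rw [hz]
  refine le_of_mul_le_mul_left ?_ hR2
  calc R ^ 2 * l2NormSq (Metric.ball 0 R) (gradient v)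
      ≤ 9 * ((p : ℝ) * (p + 1) ^ 2 * (p + 2) * l2NormSq (Metric.ball 0 R) v) := by linarith
    _ = _ := by field_simp
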